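/- Let $F:\mathbb R^3\to\mathbb R$, $(x,t,e)\mapsto F(x,t,e)$, be a $C^\infty$ function such that for all $(x,t,e)$: $F(-x,t,e)=-F(x,t,e)$, $F(x,-t,e)=F(x,t,e)$, $F(x,t+2\pi,e)=F(x,t,e)$, $F(x,t,0)=f(x)$ does not depend on $t$, and $xf(x)>0$ for $x\neq0$. Put $E(x)=\int_0^x f(u)\,du$ and, for $0<h<\sup_{\mathbb R}E$, let $T(h)$ be the minimal period of the (nonconstant, periodic) solutions of $\ddot x+f(x)=0$ on the energy level $\tfrac12\dot x^2+E(x)=h$. Let $m,p\ge1$ be integers and let $0<h_{m,p}<\sup_{\mathbb R} E$ satisfy $T(h_{m,p})=2m\pi/p$ and $T'(h_{m,p})\neq0$. Let $\phi_{m,p}(t,e)$, $0\le e<e_0$ (for some $e_0>0$), be the family of odd $2m\pi$-periodic solutions of $$\ddot x+F(x,t,e)=0 \qquad (1)$$ that emanates at $e=0$ from the odd solution of energy $h_{m,p}$. That is, there is a function $\eta\in C^\infty([0,e_0))$ with $\eta(0)=\sqrt{2h_{m,p}}$ such that, for every $e\in[0,e_0)$, $\phi_{m,p}(\cdot,e)$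 is the solution of (1) with $\phi_{m,p}(0,e)=0$ and $\dot\phi_{m,p}(0,e)=\eta(e)$, and $\phi_{m,p}(m\pi,e)=0$. (By the symmetries of $F$ such solutions are odd and $2m\pi$-periodic in $t$.) Let $\tau_{m,p}(e)=\psi_1(2m\pi,e)+\dot\psi_2(2m\pi,e)$ be the trace of the $2m\pi$-periodic Poincaré matrix of the linearization $$\ddot y+q(t,e)\,y=0,\qquad q(t,e)=\frac{\partial F}{\partial x}(\phi_{m,p}(t,e),t,e), \qquad (2)$$ where $\psi_1,\psi_2$ are the solutions of (2) with $(\psi_1,\dot\psi_1)(0)=(1,0)$ and $(\psi_2,\dot\psi_2)(0)=(0,1)$, and let $\tau'_{m,p}(0)$ be the (one-sided) derivative of $\tau_{m,p}$ at $e=0$. The solution $\phi_{m,p}(\cdot,e)$ is called elliptic if $|\tau_{m,p}(e)|<2$, hyperbolic if $|\tau_{m,p}(e)|>2$, and linearized stable if the zero solution of (2) is Lyapunov stable. (i) If $\tau'_{m,p}(0)<0$, then there is $e_1\in(0,e_0]$ such that for every $e\in(0,e_1)$ the solution $\phi_{m,p}(\cdot,e)$ is elliptic and linearized stable. (ii)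 If $\tau'_{m,p}(0)>0$, then there is $e_1\in(0,e_0]$ such that for every $e\in(0,e_1)$ the solution $\phi_{m,p}(\cdot,e)$ is hyperbolic and is Lyapunov unstable as a solution of (1). -/

import Mathlib

open scoped ContDiff

noncomputable section

namespace NewtonEq

/-- `(x, v)` solves, in phase space, the Newtonian equation `x'' + G (x, t) = 0` on the time
set `s`: `x' = v` and `v' = -G (x, t)` on `s` (one-sided derivatives at end points). -/
def IsSolOn (G : ℝ → ℝ → ℝ) (x v : ℝ → ℝ) (s : Set ℝ) : Prop :=
  ∀ t ∈ s, HasDerivWithinAt x (v t) s t ∧ HasDerivWithinAt v (-G (x t) t) s t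

/-- `x` is a solution of `x'' + G (x, t) = 0` on the whole line. -/
def IsSol (G : ℝ → ℝ → ℝ) (x : ℝ → ℝ) : Prop :=
  IsSolOn G x (deriv x) Set.univ

/-- The standing assumptions on the equation `x'' + F (x, t, e) = 0`, with `f = F (·, ·, 0)`. -/
structure IsAdmissible (F : ℝ → ℝ → ℝ → ℝ) (f : ℝ → ℝ) : Prop where
  smooth : ContDiff ℝ ∞ (fun q : ℝ × ℝ × ℝ => F q.1 q.2.1 q.2.2)
  odd : ∀ x t e, F (-x) t e = -F x t e
  even_time : ∀ x t e, F x (-t) e = F x t e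
  periodic_time : ∀ x t e, F x (t + 2 * Real.pi) e = F x t e
  autonomous : ∀ x t, F x t 0 = f x
  sign : ∀ x, x ≠ 0 → 0 < x * f x

/-! ### The autonomous equation `x'' + f (x) = 0` -/

/-- The potential energy `E (x) = ∫₀ˣ f (u) du`. -/
def potential (f : ℝ → ℝ) (x : ℝ) : ℝ := ∫ u in (0 : ℝ)..x, f u

/-- `x` is a solution of `x'' + f (x) = 0` lying on the energy level `x'² / 2 + E (x) = h`. -/
def IsSolOfEnergy (f : ℝ → ℝ) (h : ℝ) (x : ℝ → ℝ) : Prop :=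
  IsSol (fun y _ => f y) x ∧ ∀ t, (deriv x t) ^ 2 / 2 + potential f (x t) = h

/-- The period function `T (h)`: the minimal period of the solutions of `x'' + f (x) = 0` of
energy `h`. It is meaningful for `0 < h < sup E`, where these solutions are nonconstant, periodic,
and time translates of each other. -/
def periodFn (f : ℝ → ℝ) (h : ℝ) : ℝ :=
  sInf {T : ℝ | 0 < T ∧ ∃ x : ℝ → ℝ, IsSolOfEnergy f h x ∧ Function.Periodic x T}

/-! ### Hill's equation `y'' + q (t) y = 0` -/

/-- The nonlinearity `(y, t) ↦ q (t) y` of Hill's equation `y'' + q (t) y = 0`. -/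
def hill (q : ℝ → ℝ) : ℝ → ℝ → ℝ := fun y t => q t * y

/-- The solution of Hill's equation with `y (0) = a`, `y' (0) = b`. -/
def hillSol (q : ℝ → ℝ) (a b : ℝ) : ℝ → ℝ :=
  Classical.epsilon fun y : ℝ → ℝ => IsSol (hill q) y ∧ y 0 = a ∧ deriv y 0 = b

/-- The `T`-periodic Poincaré matrix of Hill's equation, built from the fundamental solutions
`ψ₁ = hillSol q 1 0` and `ψ₂ = hillSol q 0 1`. -/
def poincareMatrix (q : ℝ → ℝ) (T : ℝ) : Matrix (Fin 2) (Fin 2) ℝ :=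
  !![hillSol q 1 0 T, hillSol q 0 1 T; deriv (hillSol q 1 0) T, deriv (hillSol q 0 1) T]

/-! ### Stability notions for a solution `φ` of `x'' + G (x, t) = 0` -/

/-- The coefficient `q (t) = ∂G/∂x (φ (t), t)` of the linearization along `φ`. -/
def linCoeff (G : ℝ → ℝ → ℝ) (φ : ℝ → ℝ) : ℝ → ℝ :=
  fun t => deriv (fun x => G x t) (φ t)

/-- The trace of the `T`-periodic Poincaré matrix of the linearization along `φ`. -/
def linTrace (G : ℝ → ℝ → ℝ) (φ : ℝ → ℝ) (T : ℝ) : ℝ :=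
  (poincareMatrix (linCoeff G φ) T).trace

/-- The `T`-periodic solution `φ` is elliptic. -/
def IsElliptic (G : ℝ → ℝ → ℝ) (φ : ℝ → ℝ) (T : ℝ) : Prop := |linTrace G φ T| < 2

/-- The `T`-periodic solution `φ` is hyperbolic. -/
def IsHyperbolic (G : ℝ → ℝ → ℝ) (φ : ℝ → ℝ) (T : ℝ) : Prop := 2 < |linTrace G φ T|

/-- Lyapunov stability of `φ` in the phase plane in forward time: solutions that start near
`(φ (0), φ' (0))` stay near `(φ, φ')` for as long as they exist. For locally Lipschitz `G` they
then exist for all `t ≥ 0`, because they cannot blow up. -/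
def LyapunovStable (G : ℝ → ℝ → ℝ) (φ : ℝ → ℝ) : Prop :=
  ∀ ε > 0, ∃ δ > 0, ∀ T ≥ 0, ∀ x v : ℝ → ℝ, IsSolOn G x v (Set.Icc 0 T) →
    |x 0 - φ 0| < δ → |v 0 - deriv φ 0| < δ →
    |x T - φ T| < ε ∧ |v T - deriv φ T| < ε

/-- `φ` is Lyapunov unstable. -/
def LyapunovUnstable (G : ℝ → ℝ → ℝ) (φ : ℝ → ℝ) : Prop := ¬ LyapunovStable G φ

/-- `φ` is linearized stable: the zero solution of its linearization is stable. -/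
def LinearizedStable (G : ℝ → ℝ → ℝ) (φ : ℝ → ℝ) : Prop :=
  LyapunovStable (hill (linCoeff G φ)) (fun _ => 0)

/-! ### The odd periodic solutions that bifurcate from the autonomous equation -/

/-- `φ (·, e)`, `0 ≤ e < e₀`, is the family of odd `2mπ`-periodic solutions of
`x'' + F (x, t, e) = 0` that emanates from the odd solution of energy `h` at `e = 0`:
`φ (·, e)` is the solution with `φ (0, e) = 0` and initial velocity `η (e)`, where `η` is smooth,
`η (0) = √(2h)` and `φ (mπ, e) = 0`. By the symmetries of `F`, a solution that vanishes at `0` and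
at `mπ` is odd and `2mπ`-periodic, so that asking it to be defined on all of `ℝ` is no
restriction. -/
structure IsOddFamily (F : ℝ → ℝ → ℝ → ℝ) (m : ℕ) (h e₀ : ℝ) (η : ℝ → ℝ) (φ : ℝ → ℝ → ℝ) :
    Prop where
  pos : 0 < e₀
  smooth : ContDiffOn ℝ ∞ η (Set.Ico 0 e₀)
  start : η 0 = Real.sqrt (2 * h)
  sol : ∀ e ∈ Set.Ico 0 e₀, IsSol (fun x t => F x t e) (fun t => φ t e)
  init_pos : ∀ e ∈ Set.Ico 0 e₀, φ 0 e = 0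
  init_vel : ∀ e ∈ Set.Ico 0 e₀, deriv (fun t => φ t e) 0 = η e
  dirichlet : ∀ e ∈ Set.Ico 0 e₀, φ (m * Real.pi) e = 0

/-- The trace `τ (e)` of the `2mπ`-periodic Poincaré matrix of the linearization of
`x'' + F (x, t, e) = 0` along `φ (·, e)`. -/
def familyTrace (F : ℝ → ℝ → ℝ → ℝ) (m : ℕ) (φ : ℝ → ℝ → ℝ) (e : ℝ) : ℝ :=
  linTrace (fun x t => F x t e) (fun t => φ t e) (2 * m * Real.pi)

end NewtonEq

end

open Set Filter Topology

/-! At `e = 0` the velocity of the odd solution is a nonzero periodic solution of the linearization.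
The Poincaré matrix therefore fixes a vector, and having determinant one it has trace 2
(`linTrace_autonomous`). A nonzero one-sided derivative of the trace at 0 pushes it strictly below
or above 2 for small `e > 0`, and continuity keeps it away from -2 in the first case.

If the trace has modulus less than two, the Poincaré matrix preserves a definite quadratic form,
which bounds solutions of Hill's equation at multiples of the period and hence always
(`IsFundamental.lyapunovStable`).

If the trace exceeds 2, there are Floquet solutions with multipliers `l > 1` and `l⁻¹`. Wronskians
against them serve as coordinates for a perturbed solution. A solution starting on the unstable
direction and staying near zero would keep an unstable coordinate that must grow exponentially
(`floquet_coord_eq_zero`), so stability of the nonlinear equation is contradictory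
(`lyapunovUnstable_of_linTrace`). -/

namespace NewtonEq

/-! ### Global existence for Lipschitz equations -/

/-- Global existence for a Lipschitz vector field that vanishes at the origin. -/
theorem exists_global_solution {E : Type*} [NormedAddCommGroup E] [NormedSpace ℝ E]
    [CompleteSpace E] {f : ℝ → E → E} (hf : Continuous (Function.uncurry f)) {K : ℝ}
    (hK : 0 ≤ K) (hlip : ∀ t x y, ‖f t x - f t y‖ ≤ K * ‖x - y‖) (hzero : ∀ t, f t 0 = 0)
    (z₀ : E) : ∃ z : ℝ → E, z 0 = z₀ ∧ ∀ t, HasDerivAt z (f t (z t)) t := by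
  -- With the weight `W t = cosh (c t)` one has `|∫₀ᵗ W| ≤ W t / c` in both time directions, so the
  -- Picard operator in the weighted sup norm contracts by `K / c ≤ 1 / 2`. The summand 1 keeps `c`
  -- positive when `K = 0`.
  set c : ℝ := 2 * K + 1 with hc
  have hc0 : 0 < c := by positivity
  let W : ℝ → ℝ := fun t => Real.cosh (c * t)
  have hW0 : ∀ t, 0 < W t := fun t => Real.cosh_pos _
  have hWc : Continuous W := by fun_prop
  have hWi : ∀ t, |∫ s in (0 : ℝ)..t, W s| ≤ W t / c := by
    intro t
    have h1 : ∫ s in (0 : ℝ)..t, W s = Real.sinh (c * t) / c := by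
      have := intervalIntegral.integral_eq_sub_of_hasDerivAt (a := 0) (b := t)
        (f := fun s => Real.sinh (c * s) / c) (f' := W)
        (fun s _ => by
          have := ((hasDerivAt_id s).const_mul c).sinh.div_const c
          convert! this using 1
          simp only [W, id]; field_simp) (hWc.intervalIntegrable _ _)
      simpa using this
    rw [h1, abs_div, abs_of_pos hc0]
    gcongr
    simp only [W]
    rw [Real.abs_sinh, ← Real.cosh_abs (c * t)]
    exact (Real.sinh_lt_cosh _).le
  have hint : ∀ (w : ℝ → E), Continuous w → Continuous fun s => f s (W s • w s) := fun w hw =>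
    hf.comp (continuous_id.prodMk (hWc.smul hw))
  -- The Picard operator in the unknown `w = z / W`; its bounded continuous fixed points give
  -- solutions `z = W • w`.
  let Φ : (ℝ → E) → ℝ → E := fun w t => (W t)⁻¹ • (z₀ + ∫ s in (0 : ℝ)..t, f s (W s • w s))
  have hΦc : ∀ w : ℝ → E, Continuous w → Continuous (Φ w) := by
    intro w hw
    refine (hWc.inv₀ fun t => (hW0 t).ne').smul (continuous_const.add ?_)
    exact intervalIntegral.continuous_primitive (fun a b => (hint w hw).intervalIntegrable a b) 0
  have hbound : ∀ (g : ℝ → E), ∀ M, (∀ s, ‖g s‖ ≤ M * W s) →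
      ∀ t, ‖(W t)⁻¹ • ∫ s in (0 : ℝ)..t, g s‖ ≤ |M| / c := by
    intro g M hg t
    have h1 : ‖∫ s in (0 : ℝ)..t, g s‖ ≤ |∫ s in (0 : ℝ)..t, M * W s| :=
      intervalIntegral.norm_integral_le_abs_of_norm_le
        (Eventually.of_forall fun s => hg s)
        ((continuous_const.mul hWc).intervalIntegrable _ _)
    rw [intervalIntegral.integral_const_mul, abs_mul] at h1
    rw [norm_smul, norm_inv, Real.norm_of_nonneg (hW0 t).le, inv_mul_le_iff₀ (hW0 t)]
    calc _ ≤ |M| * |∫ s in (0 : ℝ)..t, W s| := h1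
      _ ≤ |M| * (W t / c) := by gcongr; exact hWi t
      _ = _ := by ring
  have hW1 : ∀ t, (W t)⁻¹ ≤ 1 := fun t => inv_le_one_of_one_le₀ (Real.one_le_cosh _)
  have hΦb : ∀ w : BoundedContinuousFunction ℝ E, ∀ t, ‖Φ w t‖ ≤ ‖z₀‖ + |K * ‖w‖| / c := by
    intro w t
    have h2 := hbound (fun s => f s (W s • w s)) (K * ‖w‖) (fun s => by
      have := hlip s (W s • w s) 0
      rw [hzero, sub_zero, sub_zero, norm_smul, Real.norm_of_nonneg (hW0 s).le] at this
      calc _ ≤ K * (W s * ‖w s‖) := this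
        _ ≤ K * (W s * ‖w‖) := by
          have := (hW0 s).le
          gcongr; exact w.norm_coe_le_norm s
        _ = _ := by ring) t
    simp only [Φ, smul_add]
    refine (norm_add_le _ _).trans (add_le_add ?_ h2)
    rw [norm_smul, norm_inv, Real.norm_of_nonneg (hW0 t).le]
    exact mul_le_of_le_one_left (norm_nonneg _) (hW1 t)
  let Ψ : BoundedContinuousFunction ℝ E → BoundedContinuousFunction ℝ E := fun w =>
    BoundedContinuousFunction.ofNormedAddCommGroup (Φ w) (hΦc w w.continuous) _ (hΦb w)
  have hcontr : ContractingWith (1 / 2) Ψ := by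
    refine ⟨by rw [← NNReal.coe_lt_coe]; norm_num, LipschitzWith.of_dist_le_mul fun w w' => ?_⟩
    rw [BoundedContinuousFunction.dist_le (by positivity)]
    intro t
    have h2 := hbound (fun s => f s (W s • w s) - f s (W s • w' s)) (K * dist w w') (fun s => by
      have := hlip s (W s • w s) (W s • w' s)
      rw [← smul_sub, norm_smul, Real.norm_of_nonneg (hW0 s).le] at this
      calc _ ≤ K * (W s * dist (w s) (w' s)) := by rwa [dist_eq_norm (w s)]
        _ ≤ K * (W s * dist w w') := by
          have := (hW0 s).le
          gcongr; exact w.dist_coe_le_dist s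
        _ = _ := by ring) t
    rw [intervalIntegral.integral_sub ((hint w w.continuous).intervalIntegrable _ _)
      ((hint w' w'.continuous).intervalIntegrable _ _), smul_sub] at h2
    rw [dist_eq_norm]
    have h3 : Ψ w t - Ψ w' t = (W t)⁻¹ • (∫ s in (0 : ℝ)..t, f s (W s • w s)) -
        (W t)⁻¹ • (∫ s in (0 : ℝ)..t, f s (W s • w' s)) := by
      change Φ w t - Φ w' t = _
      simp only [Φ, smul_add]; abel
    rw [h3]
    refine h2.trans ?_
    rw [abs_of_nonneg (by positivity), div_le_iff₀ hc0]
    push_cast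
    nlinarith [dist_nonneg (x := w) (y := w')]
  obtain ⟨w, hw⟩ : ∃ w, Ψ w = w := ⟨hcontr.fixedPoint, hcontr.fixedPoint_isFixedPt⟩
  have hz : ∀ t, W t • w t = z₀ + ∫ s in (0 : ℝ)..t, f s (W s • w s) := by
    intro t
    have : Φ w t = w t := congrArg (fun v : BoundedContinuousFunction ℝ E => v t) hw
    conv_lhs => rw [← this]
    simp only [Φ]
    rw [smul_smul, mul_inv_cancel₀ (hW0 t).ne', one_smul]
  refine ⟨fun t => W t • w t, (hz 0).trans (by simp), fun t => ?_⟩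
  have := (intervalIntegral.integral_hasDerivAt_right
    ((hint w w.continuous).intervalIntegrable 0 t)
    (hint w w.continuous).stronglyMeasurable.stronglyMeasurableAtFilter
    (hint w w.continuous).continuousAt).const_add z₀
  exact this.congr_of_eventuallyEq (Eventually.of_forall hz)

/-- Global existence for `x'' + g (x, t) = 0` when `g` is Lipschitz and `g (0, t) = 0`. -/
theorem exists_isSolOn_univ {g : ℝ → ℝ → ℝ} (hg : Continuous (Function.uncurry g)) {K : ℝ}
    (hlip : ∀ t x y, |g x t - g y t| ≤ K * |x - y|) (hzero : ∀ t, g 0 t = 0) (a b : ℝ) :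
    ∃ x v : ℝ → ℝ, x 0 = a ∧ v 0 = b ∧ IsSolOn g x v univ := by
  obtain ⟨z, hz0, hz⟩ := exists_global_solution
    (f := fun t (z : ℝ × ℝ) => (z.2, -g z.1 t)) (K := max 1 |K|)
    (by
      refine continuous_snd.snd.prodMk (Continuous.neg ?_)
      exact hg.comp (continuous_snd.fst.prodMk continuous_fst))
    (by positivity)
    (fun t x y => by
      simp only [Prod.norm_def, Prod.fst_sub, Prod.snd_sub, Real.norm_eq_abs]
      have h1 : |x.1 - y.1| ≤ max |x.1 - y.1| |x.2 - y.2| := le_max_left _ _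
      have h2 : |x.2 - y.2| ≤ max |x.1 - y.1| |x.2 - y.2| := le_max_right _ _
      have h0 : 0 ≤ max |x.1 - y.1| |x.2 - y.2| := (abs_nonneg _).trans h1
      refine max_le ?_ ?_
      · calc _ ≤ 1 * max |x.1 - y.1| |x.2 - y.2| := by rwa [one_mul]
          _ ≤ _ := by gcongr; exact le_max_left _ _
      · rw [show -g x.1 t - -g y.1 t = -(g x.1 t - g y.1 t) by ring, abs_neg]
        calc _ ≤ K * |x.1 - y.1| := hlip t _ _
          _ ≤ max 1 |K| * |x.1 - y.1| := by
            gcongr; exact (le_abs_self K).trans (le_max_right _ _)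
          _ ≤ _ := by gcongr)
    (fun t => by simp [hzero]) (a, b)
  refine ⟨fun t => (z t).1, fun t => (z t).2, by simp [hz0], by simp [hz0], fun t _ => ?_⟩
  have h1 : HasDerivAt (fun t => (z t).1) (z t).2 t :=
    (hasFDerivAt_fst (𝕜 := ℝ) (p := z t)).comp_hasDerivAt t (hz t)
  have h2 : HasDerivAt (fun t => (z t).2) (-g (z t).1 t) t :=
    (hasFDerivAt_snd (𝕜 := ℝ) (p := z t)).comp_hasDerivAt t (hz t)
  exact ⟨h1.hasDerivWithinAt, h2.hasDerivWithinAt⟩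

theorem IsSolOn.isSol {G : ℝ → ℝ → ℝ} {x v : ℝ → ℝ} (h : IsSolOn G x v univ) :
    IsSol G x ∧ deriv x = v := by
  have hd : deriv x = v := funext fun t => ((h t (mem_univ t)).1.hasDerivAt univ_mem).deriv
  exact ⟨by rw [IsSol, hd]; exact h, hd⟩

theorem IsSolOn.hasDerivAt {G : ℝ → ℝ → ℝ} {x v : ℝ → ℝ} (h : IsSolOn G x v univ) (t : ℝ) :
    HasDerivAt x (v t) t ∧ HasDerivAt v (-G (x t) t) t :=
  ⟨(h t (mem_univ t)).1.hasDerivAt univ_mem, (h t (mem_univ t)).2.hasDerivAt univ_mem⟩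

theorem isSolOn_univ {G : ℝ → ℝ → ℝ} {x v : ℝ → ℝ}
    (h : ∀ t, HasDerivAt x (v t) t ∧ HasDerivAt v (-G (x t) t) t) (s : Set ℝ) :
    IsSolOn G x v s :=
  fun t _ => ⟨(h t).1.hasDerivWithinAt, (h t).2.hasDerivWithinAt⟩

theorem IsSolOn.continuous {G : ℝ → ℝ → ℝ} {x v : ℝ → ℝ} (h : IsSolOn G x v univ) :
    Continuous x ∧ Continuous v :=
  ⟨continuous_iff_continuousAt.2 fun t => (h.hasDerivAt t).1.continuousAt,
    continuous_iff_continuousAt.2 fun t => (h.hasDerivAt t).2.continuousAt⟩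

/-! ### Hill's equation: fundamental solutions and Wronskian -/

theorem exists_bound_of_periodic {q : ℝ → ℝ} (hq : Continuous q) {T : ℝ} (hT : 0 < T)
    (hper : ∀ t, q (t + T) = q t) : ∃ K, 0 < K ∧ ∀ t, |q t| ≤ K := by
  obtain ⟨C, hC⟩ := (isCompact_Icc (a := (0 : ℝ)) (b := T)).exists_bound_of_continuousOn
    hq.continuousOn
  refine ⟨|C| + 1, by positivity, fun t => ?_⟩
  obtain ⟨s, hs, hst⟩ := Function.Periodic.exists_mem_Ico₀ (f := q) hper hT t
  rw [hst]
  exact (hC s (Ico_subset_Icc_self hs)).trans ((le_abs_self C).trans (by linarith))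

theorem hillSol_spec {q : ℝ → ℝ} (hq : Continuous q) {K : ℝ} (hK : ∀ t, |q t| ≤ K) (a b : ℝ) :
    IsSol (hill q) (hillSol q a b) ∧ hillSol q a b 0 = a ∧ deriv (hillSol q a b) 0 = b := by
  refine Classical.epsilon_spec
    (p := fun y : ℝ → ℝ => IsSol (hill q) y ∧ y 0 = a ∧ deriv y 0 = b) ?_
  obtain ⟨x, v, hx, hv, h⟩ := exists_isSolOn_univ (g := hill q) (K := K)
    ((hq.comp continuous_snd).mul continuous_fst)
    (fun t x y => by
      simp only [hill]
      rw [← mul_sub, abs_mul]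
      gcongr
      exact hK t) (fun t => by simp [hill]) a b
  exact ⟨x, h.isSol.1, hx, by rw [h.isSol.2, hv]⟩

/-- The Wronskian of two solutions of Hill's equation is constant. -/
theorem wronskian_const {q : ℝ → ℝ} {x v y w : ℝ → ℝ} {s : Set ℝ} (hs : Convex ℝ s)
    (hx : IsSolOn (hill q) x v s) (hy : IsSolOn (hill q) y w s) {t t' : ℝ} (ht : t ∈ s)
    (ht' : t' ∈ s) : x t * w t - v t * y t = x t' * w t' - v t' * y t' := by
  have := hs.norm_image_sub_le_of_norm_hasDerivWithin_le (C := 0)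
    (f := fun t => x t * w t - v t * y t) (f' := fun _ => 0)
    (fun r hr => by
      have := ((hx r hr).1.mul (hy r hr).2).sub ((hx r hr).2.mul (hy r hr).1)
      convert! this using 1
      simp only [hill]; ring) (fun _ _ => by simp) ht' ht
  simpa [sub_eq_zero] using this

/-- `(y₁, v₁)`, `(y₂, v₂)` are the solutions of Hill's equation, in phase space, with initial
values `(1, 0)` and `(0, 1)`. -/
structure IsFundamental (q y₁ v₁ y₂ v₂ : ℝ → ℝ) : Prop where
  sol₁ : IsSolOn (hill q) y₁ v₁ univ
  sol₂ : IsSolOn (hill q) y₂ v₂ univ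
  y₁_zero : y₁ 0 = 1
  v₁_zero : v₁ 0 = 0
  y₂_zero : y₂ 0 = 0
  v₂_zero : v₂ 0 = 1

theorem isFundamental_hillSol {q : ℝ → ℝ} (hq : Continuous q) {K : ℝ} (hK : ∀ t, |q t| ≤ K) :
    IsFundamental q (hillSol q 1 0) (deriv (hillSol q 1 0)) (hillSol q 0 1)
      (deriv (hillSol q 0 1)) := by
  obtain ⟨h1, h2, h3⟩ := hillSol_spec hq hK 1 0
  obtain ⟨h4, h5, h6⟩ := hillSol_spec hq hK 0 1
  exact ⟨h1, h4, h2, h3, h5, h6⟩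

namespace IsFundamental

variable {q y₁ v₁ y₂ v₂ : ℝ → ℝ}

theorem wronskian_eq_one (hF : IsFundamental q y₁ v₁ y₂ v₂) (t : ℝ) :
    y₁ t * v₂ t - v₁ t * y₂ t = 1 := by
  rw [wronskian_const convex_univ hF.sol₁ hF.sol₂ (mem_univ t) (mem_univ 0), hF.y₁_zero,
    hF.v₁_zero, hF.y₂_zero, hF.v₂_zero]
  ring

/-- The Wronskians of `(x, v)` with the two fundamental solutions are constant, and Cramer's rule
recovers `(x, v)` from them. This is uniqueness for Hill's equation, valid also for solutions known
only on an interval containing 0. -/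
theorem eq_combination (hF : IsFundamental q y₁ v₁ y₂ v₂) {x v : ℝ → ℝ} {s : Set ℝ}
    (hs : Convex ℝ s) (h0 : (0 : ℝ) ∈ s) (h : IsSolOn (hill q) x v s) {t : ℝ} (ht : t ∈ s) :
    x t = x 0 * y₁ t + v 0 * y₂ t ∧ v t = x 0 * v₁ t + v 0 * v₂ t := by
  have e1 := wronskian_const hs h (isSolOn_univ hF.sol₁.hasDerivAt s) ht h0
  have e2 := wronskian_const hs h (isSolOn_univ hF.sol₂.hasDerivAt s) ht h0
  have e := hF.wronskian_eq_one t
  rw [hF.y₁_zero, hF.v₁_zero] at e1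
  rw [hF.y₂_zero, hF.v₂_zero] at e2
  constructor
  · linear_combination (-x t) * e + y₁ t * e2 - y₂ t * e1
  · linear_combination (-v t) * e + v₁ t * e2 - v₂ t * e1

theorem combination (hF : IsFundamental q y₁ v₁ y₂ v₂) (a b : ℝ) :
    IsSolOn (hill q) (fun t => a * y₁ t + b * y₂ t) (fun t => a * v₁ t + b * v₂ t) univ := by
  refine isSolOn_univ (fun t => ?_) _
  have h1 := hF.sol₁.hasDerivAt t
  have h2 := hF.sol₂.hasDerivAt t
  refine ⟨(h1.1.const_mul a).add (h2.1.const_mul b), ?_⟩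
  convert! (h1.2.const_mul a).add (h2.2.const_mul b) using 1
  simp only [hill]; ring

end IsFundamental

/-! ### The elliptic case: stability of Hill's equation -/

theorem IsSolOn.hill_shift {q : ℝ → ℝ} {T : ℝ} (hper : ∀ t, q (t + T) = q t) {x v : ℝ → ℝ}
    (h : IsSolOn (hill q) x v univ) :
    IsSolOn (hill q) (fun t => x (t + T)) (fun t => v (t + T)) univ := by
  refine isSolOn_univ (fun t => ⟨(h.hasDerivAt (t + T)).1.comp_add_const t T, ?_⟩) _
  convert! (h.hasDerivAt (t + T)).2.comp_add_const t T using 1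
  simp only [hill, hper]

/-- If the monodromy matrix has trace of modulus less than two, Hill's equation is stable. -/
theorem IsFundamental.lyapunovStable {q y₁ v₁ y₂ v₂ : ℝ → ℝ}
    (hF : IsFundamental q y₁ v₁ y₂ v₂) {T : ℝ} (hT : 0 < T) (hper : ∀ t, q (t + T) = q t)
    (htr : |y₁ T + v₂ T| < 2) : LyapunovStable (hill q) fun _ => 0 := by
  have hdet := hF.wronskian_eq_one T
  set a := y₁ T
  set b := y₂ T
  set c := v₁ T
  set d := v₂ T
  obtain ⟨B, hB0, hB⟩ : ∃ B > 0, ∀ t ∈ Icc 0 T,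
      |y₁ t| ≤ B ∧ |v₁ t| ≤ B ∧ |y₂ t| ≤ B ∧ |v₂ t| ≤ B := by
    have key : ∀ g : ℝ → ℝ, Continuous g → ∃ C, 0 ≤ C ∧ ∀ t ∈ Icc 0 T, |g t| ≤ C := by
      intro g hg
      obtain ⟨C, hC⟩ := (isCompact_Icc (a := (0 : ℝ)) (b := T)).exists_bound_of_continuousOn
        hg.continuousOn
      exact ⟨|C|, abs_nonneg _, fun t ht => (hC t ht).trans (le_abs_self C)⟩
    obtain ⟨C1, p1, h1⟩ := key y₁ hF.sol₁.continuous.1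
    obtain ⟨C2, p2, h2⟩ := key v₁ hF.sol₁.continuous.2
    obtain ⟨C3, p3, h3⟩ := key y₂ hF.sol₂.continuous.1
    obtain ⟨C4, p4, h4⟩ := key v₂ hF.sol₂.continuous.2
    refine ⟨C1 + C2 + C3 + C4 + 1, by positivity, fun t ht => ?_⟩
    have := h1 t ht
    have := h2 t ht
    have := h3 t ht
    have := h4 t ht
    refine ⟨?_, ?_, ?_, ?_⟩ <;> linarith
  -- The form `c x² + (d - a) x v - b v²` has discriminant `(d - a)² + 4 b c = (a + d)² - 4 = -D`,
  -- because the determinant is one; so it is definite exactly when `D > 0`.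
  set D := 4 - (a + d) ^ 2 with hD
  have hD0 : 0 < D := by
    have := sq_lt_sq' (abs_lt.1 htr).1 (abs_lt.1 htr).2
    rw [hD]; linarith
  set N := |c| + |d - a| + |b| with hN
  set C := Real.sqrt (4 * N * N / D) with hC
  have hC2 : C ^ 2 = 4 * N * N / D := Real.sq_sqrt (by positivity)
  have hC0 : 0 ≤ C := Real.sqrt_nonneg _
  -- values at multiples of the period
  have hmult : ∀ x v : ℝ → ℝ, IsSolOn (hill q) x v univ → ∀ δ, |x 0| ≤ δ → |v 0| ≤ δ →
      ∀ n : ℕ, |x (n * T)| ≤ C * δ ∧ |v (n * T)| ≤ C * δ := by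
    intro x v h δ hx hv n
    have hδ : 0 ≤ δ := (abs_nonneg _).trans hx
    have hinv : ∀ n : ℕ, c * x (n * T) ^ 2 + (d - a) * x (n * T) * v (n * T) - b * v (n * T) ^ 2 =
        c * x 0 ^ 2 + (d - a) * x 0 * v 0 - b * v 0 ^ 2 := by
      intro n
      induction n with
      | zero => simp
      | succ n ih =>
        have hs : IsSolOn (hill q) (fun t => x (t + n * T)) (fun t => v (t + n * T)) univ :=
          h.hill_shift fun t => (show Function.Periodic q T from hper).nat_mul n t
        obtain ⟨e1, e2⟩ := hF.eq_combination convex_univ (mem_univ 0) hs (mem_univ T)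
        rw [zero_add] at e1 e2
        rw [show ((n + 1 : ℕ) : ℝ) * T = T + n * T by push_cast; ring, e1, e2, ← ih]
        linear_combination (c * x (n * T) ^ 2 + (d - a) * x (n * T) * v (n * T) -
          b * v (n * T) ^ 2) * hdet
    set Q := c * x 0 ^ 2 + (d - a) * x 0 * v 0 - b * v 0 ^ 2 with hQ
    have hQb : |Q| ≤ N * δ ^ 2 := by
      have h1 : |c * x 0 ^ 2| ≤ |c| * δ ^ 2 := by
        rw [abs_mul, abs_pow]; gcongr
      have h2 : |(d - a) * x 0 * v 0| ≤ |d - a| * δ ^ 2 := by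
        rw [abs_mul, abs_mul, mul_assoc, sq]; gcongr
      have h3 : |b * v 0 ^ 2| ≤ |b| * δ ^ 2 := by
        rw [abs_mul, abs_pow]; gcongr
      calc |Q| ≤ |c * x 0 ^ 2| + |(d - a) * x 0 * v 0| + |b * v 0 ^ 2| :=
            (abs_sub _ _).trans (add_le_add (abs_add_le _ _) le_rfl)
        _ ≤ _ := by rw [hN]; linarith
    have hn := hinv n
    have hbN : |b| ≤ N := by rw [hN]; linarith [abs_nonneg c, abs_nonneg (d - a)]
    have hcN : |c| ≤ N := by rw [hN]; linarith [abs_nonneg b, abs_nonneg (d - a)]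
    -- Completing the square gives `-4 b Q = D x² + (2 b v - (d - a) x)²` and `4 c Q = D v² + (2 c x
    -- + (d - a) v)²`, so the conserved value `Q` controls both components.
    have fin : ∀ z k : ℝ, D * z ^ 2 ≤ 4 * (k * Q) → |k| ≤ N → |z| ≤ C * δ := by
      intro z k hz hk
      refine abs_le_of_sq_le_sq ?_ (by positivity)
      rw [mul_pow, hC2, div_mul_eq_mul_div, le_div_iff₀ hD0]
      have : k * Q ≤ N * (N * δ ^ 2) := by
        calc k * Q ≤ |k * Q| := le_abs_self _
          _ = |k| * |Q| := abs_mul _ _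
          _ ≤ _ := by gcongr
      nlinarith
    refine ⟨fin _ (-b) ?_ (by rwa [abs_neg]), fin _ c ?_ hcN⟩
    · rw [← hn, hD]
      nlinarith [sq_nonneg (2 * b * v (n * T) - (d - a) * x (n * T))]
    · rw [← hn, hD]
      nlinarith [sq_nonneg (2 * c * x (n * T) + (d - a) * v (n * T))]
  have hbdd : ∀ x v : ℝ → ℝ, IsSolOn (hill q) x v univ → ∀ δ, |x 0| ≤ δ → |v 0| ≤ δ →
      ∀ t ≥ 0, |x t| ≤ 2 * B * (C * δ) ∧ |v t| ≤ 2 * B * (C * δ) := by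
    intro x v h δ hx hv t ht
    set n := ⌊t / T⌋₊
    have hn1 : n * T ≤ t := (le_div_iff₀ hT).1 (Nat.floor_le (by positivity))
    have hn2 : t < (n + 1) * T := (div_lt_iff₀ hT).1 (Nat.lt_floor_add_one _)
    have hs : IsSolOn (hill q) (fun t => x (t + n * T)) (fun t => v (t + n * T)) univ :=
      h.hill_shift fun t => (show Function.Periodic q T from hper).nat_mul n t
    obtain ⟨e1, e2⟩ := hF.eq_combination convex_univ (mem_univ 0) hs (mem_univ (t - n * T))
    rw [zero_add, sub_add_cancel] at e1 e2
    obtain ⟨m1, m2⟩ := hmult x v h δ hx hv n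
    obtain ⟨b1, b2, b3, b4⟩ := hB (t - n * T) ⟨by linarith, by linarith⟩
    have gen : ∀ α β γ ζ : ℝ, |α| ≤ C * δ → |β| ≤ C * δ → |γ| ≤ B → |ζ| ≤ B →
        |α * γ + β * ζ| ≤ 2 * B * (C * δ) := by
      intro α β γ ζ h1 h2 h3 h4
      have hCδ := (abs_nonneg _).trans h1
      calc _ ≤ |α| * |γ| + |β| * |ζ| := by
            rw [← abs_mul, ← abs_mul]; exact abs_add_le _ _
        _ ≤ (C * δ) * B + (C * δ) * B := by gcongr
        _ = _ := by ring
    rw [e1, e2]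
    exact ⟨gen _ _ _ _ m1 m2 b1 b3, gen _ _ _ _ m1 m2 b2 b4⟩
  intro ε hε
  set δ := ε / (2 * B * C + 1) with hδ
  have hδ0 : 0 < δ := by positivity
  have hδε : 2 * B * (C * δ) < ε := by
    have : (2 * B * C + 1) * δ = ε := by rw [hδ]; field_simp
    linarith
  refine ⟨δ, hδ0, fun t ht x v h hx hv => ?_⟩
  simp only [sub_zero, deriv_const] at hx hv ⊢
  -- The given solution lives only on `[0, t]`; on it, it agrees with a global combination of
  -- fundamental solutions, to which the bound applies.
  obtain ⟨e1, e2⟩ := hF.eq_combination (convex_Icc 0 t) (left_mem_Icc.2 ht) h (right_mem_Icc.2 ht)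
  have := hbdd _ _ (hF.combination (x 0) (v 0)) δ
    (by simpa [hF.y₁_zero, hF.y₂_zero] using hx.le)
    (by simpa [hF.v₁_zero, hF.v₂_zero] using hv.le) t ht
  rw [e1, e2]
  exact ⟨this.1.trans_lt hδε, this.2.trans_lt hδε⟩

/-! ### Uniqueness, symmetry and periodicity for the nonlinear equation -/

section Smooth

variable {G : ℝ → ℝ → ℝ}

theorem hasDerivAt_slice (hG : ContDiff ℝ 1 fun z : ℝ × ℝ => G z.1 z.2) (x t : ℝ) :
    HasDerivAt (fun x => G x t) (fderiv ℝ (fun z : ℝ × ℝ => G z.1 z.2) (x, t) (1, 0)) x := by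
  have h1 : HasFDerivAt (fun z : ℝ × ℝ => G z.1 z.2) _ (x, t) :=
    (hG.differentiable one_ne_zero (x, t)).hasFDerivAt
  exact h1.comp_hasDerivAt x ((hasDerivAt_id x).prodMk (hasDerivAt_const x t))

theorem continuous_deriv_slice (hG : ContDiff ℝ 1 fun z : ℝ × ℝ => G z.1 z.2) :
    Continuous fun z : ℝ × ℝ => deriv (fun x => G x z.2) z.1 := by
  have : (fun z : ℝ × ℝ => deriv (fun x => G x z.2) z.1) =
      fun z => fderiv ℝ (fun z : ℝ × ℝ => G z.1 z.2) z (1, 0) :=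
    funext fun z => (hasDerivAt_slice hG z.1 z.2).deriv
  rw [this]
  exact (hG.continuous_fderiv one_ne_zero).clm_apply continuous_const

theorem abs_slice_sub_le (hG : ContDiff ℝ 1 fun z : ℝ × ℝ => G z.1 z.2) {s : Set ℝ}
    (hs : Convex ℝ s) {t K : ℝ} (hK : ∀ x ∈ s, |deriv (fun x => G x t) x| ≤ K) {x y : ℝ}
    (hx : x ∈ s) (hy : y ∈ s) : |G x t - G y t| ≤ K * |x - y| :=
  hs.norm_image_sub_le_of_norm_deriv_le (f := fun x => G x t)
    (fun z _ => (hasDerivAt_slice hG z t).differentiableAt) hK hy hx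

/-- Uniqueness for the initial value problem. -/
theorem IsSolOn.unique (hG : ContDiff ℝ 1 fun z : ℝ × ℝ => G z.1 z.2) {x v y w : ℝ → ℝ}
    (hx : IsSolOn G x v univ) (hy : IsSolOn G y w univ) {t₀ : ℝ} (h1 : x t₀ = y t₀)
    (h2 : v t₀ = w t₀) : x = y := by
  ext t
  set A := min t t₀ - 1
  set B := max t t₀ + 1
  have ht : t ∈ Ioo A B :=
    ⟨by linarith [min_le_left t t₀], by linarith [le_max_left t t₀]⟩
  have ht₀ : t₀ ∈ Ioo A B :=
    ⟨by linarith [min_le_right t t₀], by linarith [le_max_right t t₀]⟩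
  -- On a compact time window both solutions stay in a strip `|x| ≤ R`, where a bound on `∂G/∂x`
  -- makes the vector field Lipschitz.
  obtain ⟨R1, hR1⟩ := (isCompact_Icc (a := A) (b := B)).exists_bound_of_continuousOn
    hx.continuous.1.continuousOn
  obtain ⟨R2, hR2⟩ := (isCompact_Icc (a := A) (b := B)).exists_bound_of_continuousOn
    hy.continuous.1.continuousOn
  set R := max R1 R2
  obtain ⟨K, hK⟩ := ((isCompact_Icc (a := -R) (b := R)).prod
    (isCompact_Icc (a := A) (b := B))).exists_bound_of_continuousOn
    (continuous_deriv_slice hG).continuousOn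
  have hlip : ∀ s ∈ Ioo A B, LipschitzOnWith (Real.toNNReal (max 1 K))
      (fun z : ℝ × ℝ => (z.2, -G z.1 s)) {z | z.1 ∈ Icc (-R) R} := by
    intro s hs
    refine LipschitzOnWith.of_dist_le_mul fun z hz z' hz' => ?_
    rw [Real.coe_toNNReal _ (by positivity), Prod.dist_eq, Prod.dist_eq, Real.dist_eq,
      Real.dist_eq, Real.dist_eq]
    have hd1 := le_max_left |z.1 - z'.1| |z.2 - z'.2|
    have hd2 := le_max_right |z.1 - z'.1| |z.2 - z'.2|
    have hd0 := (abs_nonneg _).trans hd1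
    refine max_le ?_ ?_
    · calc _ ≤ 1 * max |z.1 - z'.1| |z.2 - z'.2| := by rwa [one_mul]
        _ ≤ _ := by gcongr; exact le_max_left _ _
    · rw [show -G z.1 s - -G z'.1 s = -(G z.1 s - G z'.1 s) by ring, abs_neg]
      calc _ ≤ K * |z.1 - z'.1| := abs_slice_sub_le hG (convex_Icc (-R) R)
            (fun r hr => hK (r, s) ⟨hr, Ioo_subset_Icc_self hs⟩) hz hz'
        _ ≤ max 1 K * |z.1 - z'.1| := by gcongr; exact le_max_right _ _
        _ ≤ _ := by gcongr
  have := ODE_solution_unique_of_mem_Ioo (f := fun t => (x t, v t)) (g := fun t => (y t, w t))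
    (v := fun s (z : ℝ × ℝ) => (z.2, -G z.1 s)) (s := fun _ => {z | z.1 ∈ Icc (-R) R})
    hlip ht₀
    (fun s hs => ⟨(hx.hasDerivAt s).1.prodMk (hx.hasDerivAt s).2,
      abs_le.1 ((hR1 s (Ioo_subset_Icc_self hs)).trans (le_max_left _ _))⟩)
    (fun s hs => ⟨(hy.hasDerivAt s).1.prodMk (hy.hasDerivAt s).2,
      abs_le.1 ((hR2 s (Ioo_subset_Icc_self hs)).trans (le_max_right _ _))⟩)
    (by simp [h1, h2]) ht
  exact congrArg Prod.fst this

/-- A solution that vanishes at a centre of symmetry `c` of an odd equation is odd about `c`. -/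
theorem IsSol.reflect (hG : ContDiff ℝ 1 fun z : ℝ × ℝ => G z.1 z.2)
    (hodd : ∀ x t, G (-x) t = -G x t) {c : ℝ} (hrefl : ∀ x t, G x (2 * c - t) = G x t)
    {φ : ℝ → ℝ} (hφ : IsSol G φ) (hc : φ c = 0) (t : ℝ) : φ (2 * c - t) = -φ t := by
  have hs : IsSolOn G (fun t => -φ (2 * c - t)) (fun t => deriv φ (2 * c - t)) univ := by
    refine isSolOn_univ (fun t => ?_) _
    have h := IsSolOn.hasDerivAt hφ (2 * c - t)
    constructor
    · convert! (h.1.comp_const_sub (2 * c) t).neg using 1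
      ring
    · convert! h.2.comp_const_sub (2 * c) t using 1
      simp only [hodd, hrefl]
  have := congrFun (hs.unique hG hφ (t₀ := c) (by ring_nf; simp [hc]) (by ring_nf)) t
  linarith

/-- The solution is odd about 0 and about `c`; the composition of the two reflections is the
translation by `2 c`. -/
theorem IsSol.periodic (hG : ContDiff ℝ 1 fun z : ℝ × ℝ => G z.1 z.2)
    (hodd : ∀ x t, G (-x) t = -G x t) (heven : ∀ x t, G x (-t) = G x t) {c : ℝ}
    (hper : ∀ x t, G x (t + 2 * c) = G x t) {φ : ℝ → ℝ} (hφ : IsSol G φ) (h0 : φ 0 = 0)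
    (hc : φ c = 0) (t : ℝ) : φ (t + 2 * c) = φ t := by
  have e1 := hφ.reflect hG hodd (c := 0) (fun x t => by rw [mul_zero, zero_sub, heven]) h0 t
  have e2 := hφ.reflect hG hodd (c := c)
    (fun x t => by rw [show 2 * c - t = -t + 2 * c by ring, hper, heven]) hc (-t)
  rw [mul_zero, zero_sub] at e1
  rw [show t + 2 * c = 2 * c - -t by ring, e2, e1, neg_neg]

theorem continuous_linCoeff (hG : ContDiff ℝ 1 fun z : ℝ × ℝ => G z.1 z.2) {φ : ℝ → ℝ}
    (hφ : IsSol G φ) : Continuous (linCoeff G φ) :=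
  (continuous_deriv_slice hG).comp ((IsSolOn.continuous hφ).1.prodMk continuous_id)

theorem linCoeff_periodic {φ : ℝ → ℝ} {T : ℝ} (hper : ∀ x t, G x (t + T) = G x t)
    (hφ : ∀ t, φ (t + T) = φ t) (t : ℝ) : linCoeff G φ (t + T) = linCoeff G φ t := by
  simp only [linCoeff, hper, hφ]

end Smooth

/-! ### The trace at the autonomous equation -/

theorem linTrace_eq (G : ℝ → ℝ → ℝ) (φ : ℝ → ℝ) (T : ℝ) :
    linTrace G φ T = hillSol (linCoeff G φ) 1 0 T + deriv (hillSol (linCoeff G φ) 0 1) T := by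
  simp [linTrace, poincareMatrix, Matrix.trace_fin_two]

/-- The linearization of an autonomous equation along a periodic solution has trace two. -/
theorem linTrace_autonomous {f : ℝ → ℝ} (hf : ContDiff ℝ 1 f) (hf0 : f 0 = 0) {φ : ℝ → ℝ}
    (hφ : IsSol (fun x _ => f x) φ) {T : ℝ} (hT : 0 < T) (hper : ∀ t, φ (t + T) = φ t)
    (h0 : φ 0 = 0) (hv : deriv φ 0 ≠ 0) : linTrace (fun x _ => f x) φ T = 2 := by
  have hG : ContDiff ℝ 1 fun z : ℝ × ℝ => (fun x _ => f x : ℝ → ℝ → ℝ) z.1 z.2 :=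
    hf.comp contDiff_fst
  set q := linCoeff (fun x _ => f x) φ with hq
  have hqc : Continuous q := continuous_linCoeff hG hφ
  obtain ⟨K, -, hK⟩ := exists_bound_of_periodic hqc hT
    (linCoeff_periodic (G := fun x _ => f x) (fun _ _ => rfl) hper)
  have hF := isFundamental_hillSol hqc hK
  -- Differentiating `φ'' + f(φ) = 0` in time shows that `φ'` solves the linearization. Its initial
  -- vector `(φ' 0, 0)` returns to itself after time `T`, so the first column of the Poincaré matrix
  -- is `(1, 0)`.
  have hsol : IsSolOn (hill q) (deriv φ) (fun t => -f (φ t)) univ := by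
    refine isSolOn_univ (fun t => ⟨(IsSolOn.hasDerivAt hφ t).2, ?_⟩) _
    have h1 : HasDerivAt f (deriv f (φ t)) (φ t) :=
      (hf.differentiable one_ne_zero (φ t)).hasDerivAt
    exact (h1.comp t (IsSolOn.hasDerivAt hφ t).1).neg
  obtain ⟨e1, e2⟩ := hF.eq_combination convex_univ (mem_univ 0) hsol (mem_univ T)
  have hφT : φ T = 0 := by have := hper 0; rwa [zero_add, h0] at this
  have hdT : deriv φ T = deriv φ 0 := by
    have h1 : (fun t => φ (t + T)) = φ := funext hper
    have h2 := deriv_comp_add_const φ T 0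
    rw [h1, zero_add] at h2
    exact h2.symm
  rw [hdT, h0, hf0, neg_zero, zero_mul, add_zero] at e1
  rw [hφT, h0, hf0, neg_zero, zero_mul, add_zero] at e2
  have e3 : hillSol q 1 0 T = 1 := (mul_left_cancel₀ hv (by rw [mul_one]; exact e1)).symm
  have e4 : deriv (hillSol q 1 0) T = 0 := by
    rcases mul_eq_zero.1 e2.symm with h | h
    · exact absurd h hv
    · exact h
  have e5 := hF.wronskian_eq_one T
  rw [e3, e4] at e5
  rw [linTrace_eq, ← hq, e3]
  linarith

/-! ### The hyperbolic case: instability by linearization -/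

/-- Eigenvectors of a unimodular matrix with trace larger than two. -/
theorem exists_hyperbolic_eigenvectors {a b c d : ℝ} (hdet : a * d - c * b = 1)
    (htr : 2 < a + d) : ∃ l > 1, ∃ u₁ u₂ s₁ s₂ : ℝ,
      u₁ * a + u₂ * b = l * u₁ ∧ u₁ * c + u₂ * d = l * u₂ ∧
      s₁ * a + s₂ * b = l⁻¹ * s₁ ∧ s₁ * c + s₂ * d = l⁻¹ * s₂ ∧ s₁ * u₂ - s₂ * u₁ ≠ 0 := by
  set r := Real.sqrt ((a + d) ^ 2 - 4) with hr
  have hr2 : r ^ 2 = (a + d) ^ 2 - 4 := Real.sq_sqrt (by nlinarith)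
  have hr0 : 0 < r := Real.sqrt_pos.2 (by nlinarith)
  set l := (a + d + r) / 2 with hl
  set k := (a + d - r) / 2 with hk
  have hlk : l * k = 1 := by rw [hl, hk]; linear_combination (-1 / 4) * hr2
  have hsum : l + k = a + d := by rw [hl, hk]; ring
  have hinv : l⁻¹ = k := inv_eq_of_mul_eq_one_right hlk
  have hl1 : 1 < l := by rw [hl]; linarith
  have hlt : k < l := by rw [hl, hk]; linarith
  have hchl : (l - a) * (l - d) = b * c := by
    linear_combination l * hsum - hlk + hdet
  have hchk : (k - a) * (k - d) = b * c := by
    linear_combination k * hsum - hlk + hdet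
  refine ⟨l, hl1, ?_⟩
  rw [hinv]
  -- Generically the eigenvectors are `(b, l - a)` and `(b, k - a)`. For `b = 0` these can
  -- degenerate, but the matrix is then triangular with `l`, `k` on its diagonal in some order.
  by_cases hb : b = 0
  · subst hb
    rcases mul_eq_zero.1 (hchl.trans (zero_mul c)) with h | h
    · have ha : a = l := by linarith
      have hd : d = k := by linarith
      refine ⟨l - k, c, 0, 1, ?_, ?_, ?_, ?_, ?_⟩
      · rw [ha]; ring
      · rw [hd]; ring
      · ring
      · rw [hd]; ring
      · simp [sub_eq_zero]; linarith
    · have hd : d = l := by linarith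
      have ha : a = k := by linarith
      refine ⟨0, 1, k - l, c, ?_, ?_, ?_, ?_, ?_⟩
      · ring
      · rw [hd]; ring
      · rw [ha]; ring
      · rw [hd]; ring
      · simp [sub_eq_zero]; linarith
  · refine ⟨b, l - a, b, k - a, by ring, ?_, by ring, ?_, ?_⟩
    · linear_combination -hchl
    · linear_combination -hchk
    · rw [show b * (l - a) - (k - a) * b = b * (l - k) by ring]
      exact mul_ne_zero hb (by linarith)

/-- The Floquet solution of Hill's equation with multiplier `exp (σ T)`: its periodic part. -/
theorem IsFundamental.exists_floquet {q y₁ v₁ y₂ v₂ : ℝ → ℝ}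
    (hF : IsFundamental q y₁ v₁ y₂ v₂) {T : ℝ} (hT : 0 < T) (hper : ∀ t, q (t + T) = q t)
    {σ α β : ℝ} (h1 : α * y₁ T + β * y₂ T = Real.exp (σ * T) * α)
    (h2 : α * v₁ T + β * v₂ T = Real.exp (σ * T) * β) :
    ∃ p r : ℝ → ℝ, p 0 = α ∧ r 0 = β ∧ (∀ t, HasDerivAt p (r t - σ * p t) t) ∧
      (∀ t, HasDerivAt r (-(σ * r t) - q t * p t) t) ∧
      ∃ C, 0 < C ∧ ∀ t, |p t| ≤ C ∧ |r t| ≤ C := by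
  set y : ℝ → ℝ := fun t => α * y₁ t + β * y₂ t with hy
  set v : ℝ → ℝ := fun t => α * v₁ t + β * v₂ t with hv
  have hs : IsSolOn (hill q) y v univ := hF.combination α β
  have hy0 : y 0 = α := by simp [hy, hF.y₁_zero, hF.y₂_zero]
  have hv0 : v 0 = β := by simp [hv, hF.v₁_zero, hF.v₂_zero]
  have hshift : ∀ t, y (t + T) = Real.exp (σ * T) * y t ∧ v (t + T) = Real.exp (σ * T) * v t := by
    intro t
    obtain ⟨e1, e2⟩ :=
      hF.eq_combination convex_univ (mem_univ 0) (hs.hill_shift hper) (mem_univ t)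
    rw [zero_add, show y T = Real.exp (σ * T) * α from h1,
      show v T = Real.exp (σ * T) * β from h2] at e1 e2
    rw [e1, e2]
    constructor <;> simp only [hy, hv] <;> ring
  have hE : ∀ t, HasDerivAt (fun t => Real.exp (-(σ * t))) (-σ * Real.exp (-(σ * t))) t := by
    intro t
    convert! ((hasDerivAt_id t).const_mul σ).neg.exp using 1
    simp; ring
  have hpd : ∀ t, HasDerivAt (fun t => Real.exp (-(σ * t)) * y t)
      (Real.exp (-(σ * t)) * v t - σ * (Real.exp (-(σ * t)) * y t)) t := by
    intro t
    convert! (hE t).mul (hs.hasDerivAt t).1 using 1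
    ring
  have hrd : ∀ t, HasDerivAt (fun t => Real.exp (-(σ * t)) * v t)
      (-(σ * (Real.exp (-(σ * t)) * v t)) - q t * (Real.exp (-(σ * t)) * y t)) t := by
    intro t
    convert! (hE t).mul (hs.hasDerivAt t).2 using 1
    simp only [hill]; ring
  have hexp : ∀ t, Real.exp (-(σ * (t + T))) * Real.exp (σ * T) = Real.exp (-(σ * t)) := by
    intro t
    rw [← Real.exp_add]; ring_nf
  obtain ⟨C1, hC1, hp⟩ := exists_bound_of_periodic
    (continuous_iff_continuousAt.2 fun t => (hpd t).continuousAt) hT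
    (fun t => by rw [(hshift t).1, ← mul_assoc, hexp])
  obtain ⟨C2, hC2, hr⟩ := exists_bound_of_periodic
    (continuous_iff_continuousAt.2 fun t => (hrd t).continuousAt) hT
    (fun t => by rw [(hshift t).2, ← mul_assoc, hexp])
  exact ⟨_, _, by simp [hy0], by simp [hv0], hpd, hrd, max C1 C2, lt_max_of_lt_left hC1,
    fun t => ⟨(hp t).trans (le_max_left _ _), (hr t).trans (le_max_right _ _)⟩⟩

/-- A continuous function that cannot reach modulus one stays below. -/
theorem abs_le_one_of_no_exit {u : ℝ → ℝ} (hu : Continuous u) (h0 : |u 0| < 1)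
    (hexit : ∀ t ≥ 0, (∀ s ∈ Icc 0 t, |u s| ≤ 1) → |u t| < 1) : ∀ t ≥ 0, |u t| ≤ 1 := by
  by_contra! hcon
  obtain ⟨t, ht, h1⟩ := hcon
  have hivt : ∀ s ≥ 0, 1 < |u s| → ∃ r ∈ Icc 0 s, |u r| = 1 := fun s hs h =>
    intermediate_value_Icc hs hu.abs.continuousOn ⟨h0.le, h.le⟩
  -- The infimum of `S` is the first exit time; before it the modulus is at most one, so the no-exit
  -- hypothesis applies at that very time.
  set S := {s : ℝ | 0 ≤ s ∧ |u s| = 1} with hS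
  have hSc : IsClosed S :=
    (isClosed_le continuous_const continuous_id).inter (isClosed_eq hu.abs continuous_const)
  have hSb : BddBelow S := ⟨0, fun s hs => hs.1⟩
  have hSn : S.Nonempty := by
    obtain ⟨r, hr, hr1⟩ := hivt t ht h1
    exact ⟨r, hr.1, hr1⟩
  have hmem := hSc.csInf_mem hSn hSb
  refine (hexit _ hmem.1 fun s hs => ?_).ne hmem.2
  by_contra! hlt
  obtain ⟨r, hr, hr1⟩ := hivt s hs.1 hlt
  have := csInf_le hSb (show r ∈ S from ⟨hr.1, hr1⟩)
  have hrs : r = s := le_antisymm hr.2 (hs.2.trans this)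
  rw [hrs] at hr1
  exact hlt.ne' hr1

/-- A solution `u` of a small linear perturbation of Hill's equation that is bounded in forward
time and starts on the unstable direction is trivial. Here `exp (ρ t) p` and `exp (-ρ t) p'` are
Floquet solutions. -/
theorem floquet_coord_eq_zero {q p r p' r' g u v : ℝ → ℝ} {ρ C w : ℝ} (hρ : 0 < ρ) (hC : 0 < C)
    (hp : ∀ t, HasDerivAt p (r t - ρ * p t) t)
    (hr : ∀ t, HasDerivAt r (-(ρ * r t) - q t * p t) t)
    (hp' : ∀ t, HasDerivAt p' (r' t - -ρ * p' t) t)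
    (hr' : ∀ t, HasDerivAt r' (-(-ρ * r' t) - q t * p' t) t)
    (hbp : ∀ t, |p t| ≤ C) (hbp' : ∀ t, |p' t| ≤ C) (hbr' : ∀ t, |r' t| ≤ C)
    (hw : w ≠ 0) (hwconst : ∀ t, p' t * r t - r' t * p t = w)
    (hu : ∀ t, HasDerivAt u (v t) t) (hv : ∀ t, HasDerivAt v (-(q t * u t + g t)) t)
    (hgb : ∀ t ≥ 0, |g t| ≤ ρ * |w| / (4 * C ^ 2) * |u t|)
    (hu1 : ∀ t ≥ 0, |u t| ≤ 1) (hv1 : ∀ t ≥ 0, |v t| ≤ 1) (hb0 : p 0 * v 0 - r 0 * u 0 = 0) :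
    p' 0 * v 0 - r' 0 * u 0 = 0 := by
  have hw0 : 0 < |w| := abs_pos.2 hw
  -- Wronskian coordinates: up to the perturbation `g`, `a` satisfies `a' = ρ a` and `b` satisfies
  -- `b' = -ρ b`.
  set a : ℝ → ℝ := fun t => p' t * v t - r' t * u t with ha
  set b : ℝ → ℝ := fun t => p t * v t - r t * u t with hb
  have had : ∀ t, HasDerivAt a (ρ * a t - p' t * g t) t := by
    intro t
    convert! ((hp' t).mul (hv t)).sub ((hr' t).mul (hu t)) using 1
    simp only [ha]; ring
  have hbd : ∀ t, HasDerivAt b (-ρ * b t - p t * g t) t := by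
    intro t
    convert! ((hp t).mul (hv t)).sub ((hr t).mul (hu t)) using 1
    simp only [hb]; ring
  have hE : ∀ t, HasDerivAt (fun t => Real.exp (-(ρ * t))) (-ρ * Real.exp (-(ρ * t))) t := by
    intro t
    convert! ((hasDerivAt_id t).const_mul ρ).neg.exp using 1
    simp; ring
  -- Without `g`, `Z'` is `exp (-ρ t) (ρ a² + 3 ρ b²)`. The constant in `hgb` makes the perturbing
  -- term at most `ρ (a² + b²)` inside the bracket, so `Z` is monotone and `a² ≥ Z 0 * exp (ρ t)`.
  set Z : ℝ → ℝ := fun t => Real.exp (-(ρ * t)) * (a t ^ 2 - b t ^ 2) with hZ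
  have hZd : ∀ t, HasDerivAt Z (Real.exp (-(ρ * t)) * (ρ * a t ^ 2 + 3 * ρ * b t ^ 2 -
      2 * g t * (a t * p' t - b t * p t))) t := by
    intro t
    convert! (hE t).mul (((had t).pow 2).sub ((hbd t).pow 2)) using 1
    simp only [Nat.cast_ofNat, Nat.add_one_sub_one, pow_one, Pi.sub_apply, Pi.pow_apply]; ring
  have hmono : MonotoneOn Z (Ici 0) := by
    refine monotoneOn_of_deriv_nonneg (convex_Ici 0)
      (fun t _ => (hZd t).continuousAt.continuousWithinAt)
      (fun t _ => (hZd t).differentiableAt.differentiableWithinAt) fun t ht => ?_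
    rw [interior_Ici] at ht
    rw [(hZd t).deriv]
    refine mul_nonneg (Real.exp_pos _).le ?_
    have hm : |a t * p' t - b t * p t| ≤ C * (|a t| + |b t|) := by
      calc _ ≤ |a t| * |p' t| + |b t| * |p t| := by
            rw [← abs_mul, ← abs_mul]; exact abs_sub _ _
        _ ≤ |a t| * C + |b t| * C := by gcongr; exacts [hbp' t, hbp t]
        _ = _ := by ring
    have hum : |w| * |u t| ≤ C * (|a t| + |b t|) := by
      have : w * u t = p t * a t - p' t * b t := by
        rw [← hwconst t]; simp only [ha, hb]; ring
      rw [← abs_mul, this]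
      calc _ ≤ |p t| * |a t| + |p' t| * |b t| := by
            rw [← abs_mul, ← abs_mul]; exact abs_sub _ _
        _ ≤ C * |a t| + C * |b t| := by gcongr; exacts [hbp t, hbp' t]
        _ = _ := by ring
    have hg1 : |g t| ≤ ρ / (4 * C) * (|a t| + |b t|) := by
      calc _ ≤ ρ * |w| / (4 * C ^ 2) * |u t| := hgb t (le_of_lt ht)
        _ = ρ / (4 * C ^ 2) * (|w| * |u t|) := by ring
        _ ≤ ρ / (4 * C ^ 2) * (C * (|a t| + |b t|)) := by gcongr
        _ = _ := by field_simp
    have hfin : |2 * g t * (a t * p' t - b t * p t)| ≤ ρ * (a t ^ 2 + b t ^ 2) := by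
      calc _ = 2 * |g t| * |a t * p' t - b t * p t| := by rw [abs_mul, abs_mul, abs_two]
        _ ≤ 2 * (ρ / (4 * C) * (|a t| + |b t|)) * (C * (|a t| + |b t|)) := by gcongr
        _ = ρ / 2 * (|a t| + |b t|) ^ 2 := by field_simp; ring
        _ ≤ ρ / 2 * (2 * (|a t| ^ 2 + |b t| ^ 2)) := by gcongr; exact add_sq_le
        _ = _ := by rw [sq_abs, sq_abs]; ring
    have h1 := (abs_le.1 hfin).2
    have h2 := mul_nonneg hρ.le (sq_nonneg (b t))
    linarith
  by_contra hne
  have hZ0pos : 0 < Z 0 := by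
    have hb00 : b 0 = 0 := hb0
    have ha00 : a 0 ≠ 0 := hne
    simp only [hZ, hb00]
    rw [mul_zero, neg_zero, Real.exp_zero]
    have h2 : 0 < a 0 ^ 2 := by positivity
    linarith
  have hab : ∀ t ≥ 0, a t ^ 2 ≤ 4 * C ^ 2 := by
    intro t ht
    have h1 := hu1 t ht
    have h2 := hv1 t ht
    have : |a t| ≤ 2 * C := by
      calc _ ≤ |p' t| * |v t| + |r' t| * |u t| := by
            rw [← abs_mul, ← abs_mul]; exact abs_sub _ _
        _ ≤ C * 1 + C * 1 := by gcongr; exacts [hbp' t, hbr' t]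
        _ = _ := by ring
    calc a t ^ 2 = |a t| ^ 2 := (sq_abs _).symm
      _ ≤ (2 * C) ^ 2 := by gcongr
      _ = _ := by ring
  -- At this time `Z 0 * (ρ t)` already equals the bound `4 C²` on `a²`, whereas `exp (ρ t) ≥ 1 + ρ
  -- t` makes `Z 0 * exp (ρ t)` strictly larger.
  set t := 4 * C ^ 2 / (Z 0 * ρ) with ht
  have ht0 : 0 ≤ t := by positivity
  have h1 : Z 0 ≤ Real.exp (-(ρ * t)) * (4 * C ^ 2) := by
    refine (hmono (mem_Ici.2 le_rfl) ht0 ht0).trans ?_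
    have := hab t ht0
    simp only [hZ]
    gcongr
    linarith [sq_nonneg (b t)]
  rw [Real.exp_neg, inv_mul_eq_div, le_div_iff₀ (Real.exp_pos _)] at h1
  have h2 := Real.add_one_le_exp (ρ * t)
  have h3 : Z 0 * (ρ * t) = 4 * C ^ 2 := by rw [ht]; field_simp
  nlinarith

/-- Instability by linearization: if the monodromy matrix of the linear part has trace larger
than two, the zero solution of `u'' + H (u, t) = 0` is unstable. -/
theorem IsFundamental.lyapunovUnstable {H : ℝ → ℝ → ℝ} {q y₁ v₁ y₂ v₂ : ℝ → ℝ}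
    (hF : IsFundamental q y₁ v₁ y₂ v₂) {T : ℝ} (hT : 0 < T) (hper : ∀ t, q (t + T) = q t)
    (htr : 2 < y₁ T + v₂ T) (hH : Continuous (Function.uncurry H)) (hH0 : ∀ t, H 0 t = 0)
    {K : ℝ} (hlip : ∀ t, ∀ x ∈ Icc (-1 : ℝ) 1, ∀ y ∈ Icc (-1 : ℝ) 1,
      |H x t - H y t| ≤ K * |x - y|)
    (hlin : ∀ κ > 0, ∃ ε > 0, ∀ t u, |u| ≤ ε → |H u t - q t * u| ≤ κ * |u|) :
    LyapunovUnstable H fun _ => 0 := by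
  intro hst
  obtain ⟨l, hl, α, β, α', β', hu1, hu2, hs1, hs2, hW⟩ :=
    exists_hyperbolic_eigenvectors (hF.wronskian_eq_one T) htr
  set ρ := Real.log l / T with hρdef
  have hρ : 0 < ρ := div_pos (Real.log_pos hl) hT
  have hρT : Real.exp (ρ * T) = l := by
    rw [hρdef, div_mul_cancel₀ _ hT.ne', Real.exp_log (by linarith)]
  have hρT' : Real.exp (-ρ * T) = l⁻¹ := by rw [neg_mul, Real.exp_neg, hρT]
  obtain ⟨p, r, hp0, hr0, hp, hr, C1, hC1, hb1⟩ :=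
    hF.exists_floquet hT hper (σ := ρ) (α := α) (β := β) (by rw [hρT, hu1]) (by rw [hρT, hu2])
  obtain ⟨p', r', hp0', hr0', hp', hr', C2, hC2, hb2⟩ :=
    hF.exists_floquet hT hper (σ := -ρ) (α := α') (β := β') (by rw [hρT', hs1])
      (by rw [hρT', hs2])
  obtain ⟨C, hC, hbp, hbr, hbp', hbr'⟩ : ∃ C > 0, (∀ t, |p t| ≤ C) ∧ (∀ t, |r t| ≤ C) ∧
      (∀ t, |p' t| ≤ C) ∧ ∀ t, |r' t| ≤ C :=
    ⟨max C1 C2, lt_max_of_lt_left hC1, fun t => (hb1 t).1.trans (le_max_left _ _),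
      fun t => (hb1 t).2.trans (le_max_left _ _), fun t => (hb2 t).1.trans (le_max_right _ _),
      fun t => (hb2 t).2.trans (le_max_right _ _)⟩
  set w := α' * β - β' * α with hw
  have hwconst : ∀ t, p' t * r t - r' t * p t = w := by
    intro t
    have hd : ∀ t, HasDerivAt (fun t => p' t * r t - r' t * p t) 0 t := by
      intro t
      convert! ((hp' t).mul (hr t)).sub ((hr' t).mul (hp t)) using 1
      ring
    rw [is_const_of_deriv_eq_zero (fun t => (hd t).differentiableAt) (fun t => (hd t).deriv) t 0,
      hp0, hr0, hp0', hr0']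
  have hw0 : 0 < |w| := abs_pos.2 hW
  obtain ⟨ε₀, hε₀, hsmall⟩ := hlin (ρ * |w| / (4 * C ^ 2)) (by positivity)
  obtain ⟨δ, hδ, hstab⟩ := hst (min ε₀ (1 / 2)) (by positivity)
  set s := min δ 1 / (2 * C) with hs
  have hs0 : 0 < s := by positivity
  have hsC : s * C < min δ 1 := by
    have : 0 < min δ 1 := by positivity
    rw [hs, div_mul_eq_mul_div, div_lt_iff₀ (by positivity)]
    nlinarith
  -- the equation truncated outside `[-1, 1]`
  have hclamp : ∀ x : ℝ, max (-1) (min 1 x) ∈ Icc (-1 : ℝ) 1 := fun x =>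
    ⟨le_max_left _ _, max_le (by norm_num) (min_le_left _ _)⟩
  have hclampK : ∀ x y : ℝ, |max (-1) (min 1 x) - max (-1) (min 1 y)| ≤ |x - y| := by
    intro x y
    have h1 := abs_max_sub_max_le_max (-1 : ℝ) (min 1 x) (-1) (min 1 y)
    have h2 := abs_min_sub_min_le_max (1 : ℝ) x 1 y
    exact h1.trans (max_le (by simp) (h2.trans (max_le (by simp) le_rfl)))
  obtain ⟨u, v, hu0, hv0, huv⟩ := exists_isSolOn_univ
    (g := fun x t => H (max (-1) (min 1 x)) t) (K := |K|)
    (hH.comp (f := fun z : ℝ × ℝ => (max (-1) (min 1 z.1), z.2)) (by fun_prop))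
    (fun t x y => (hlip t _ (hclamp x) _ (hclamp y)).trans
      (mul_le_mul (le_abs_self K) (hclampK x y) (abs_nonneg _) (abs_nonneg _)))
    (fun t => by simp [hH0]) (s * p 0) (s * r 0)
  have hini : ∀ z : ℝ, |z| ≤ C → |s * z| < min δ 1 := fun z hz => by
    rw [abs_mul, abs_of_pos hs0]
    exact (mul_le_mul_of_nonneg_left hz hs0.le).trans_lt hsC
  have hclampid : ∀ x : ℝ, |x| ≤ 1 → max (-1) (min 1 x) = x := fun x hx => by
    rw [min_eq_right (abs_le.1 hx).2, max_eq_right (abs_le.1 hx).1]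
  -- While `|u| ≤ 1` the truncation is invisible, so the assumed stability applies and yields `|u| <
  -- 1 / 2`; hence `u` never leaves `[-1, 1]`.
  have hnear : ∀ t ≥ 0, (∀ s ∈ Icc 0 t, |u s| ≤ 1) →
      |u t| < min ε₀ (1 / 2) ∧ |v t| < min ε₀ (1 / 2) := by
    intro t ht hle
    have h := hstab t ht u v
      (fun s hs => by
        have h := huv.hasDerivAt s
        simp only [hclampid _ (hle s hs)] at h
        exact ⟨h.1.hasDerivWithinAt, h.2.hasDerivWithinAt⟩)
      (by rw [hu0, sub_zero]; exact (hini _ (hbp 0)).trans_le (min_le_left _ _))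
      (by
        rw [hv0, deriv_const, sub_zero]
        exact (hini _ (hbr 0)).trans_le (min_le_left _ _))
    simpa using h
  have hle1 : ∀ t ≥ 0, |u t| ≤ 1 := abs_le_one_of_no_exit huv.continuous.1
    (by rw [hu0]; exact (hini _ (hbp 0)).trans_le (min_le_right _ _))
    (fun t ht h => (hnear t ht h).1.trans ((min_le_right _ _).trans_lt (by norm_num)))
  have hnear' : ∀ t ≥ 0, |u t| < min ε₀ (1 / 2) ∧ |v t| < min ε₀ (1 / 2) := fun t ht =>
    hnear t ht fun s hs => hle1 s hs.1
  have hfin := floquet_coord_eq_zero (g := fun t => H (max (-1) (min 1 (u t))) t - q t * u t)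
    hρ hC hp hr hp' hr' hbp hbp' hbr' hW hwconst (fun t => (huv.hasDerivAt t).1)
    (fun t => by
      convert! (huv.hasDerivAt t).2 using 1
      ring)
    (fun t ht => by
      simp only [hclampid _ (hle1 t ht)]
      exact hsmall t _ ((hnear' t ht).1.le.trans (min_le_left _ _)))
    hle1 (fun t ht => (hnear' t ht).2.le.trans ((min_le_right _ _).trans (by norm_num)))
    (by rw [hu0, hv0]; ring)
  rw [hu0, hv0] at hfin
  -- The unstable coordinate of the chosen initial vector is `s * w`, with `s > 0` and `w ≠ 0`.
  exact mul_ne_zero hs0.ne' hW (by rw [← hwconst 0]; linear_combination hfin)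

/-- Stability of `φ` is stability of the zero solution of the equation for `u = x - φ`. -/
theorem LyapunovStable.sub {G : ℝ → ℝ → ℝ} {φ : ℝ → ℝ} (hφ : IsSol G φ)
    (h : LyapunovStable G φ) :
    LyapunovStable (fun u t => G (φ t + u) t - G (φ t) t) fun _ => 0 := by
  intro ε hε
  obtain ⟨δ, hδ, hst⟩ := h ε hε
  refine ⟨δ, hδ, fun T hT u v huv hu hv => ?_⟩
  simp only [sub_zero, deriv_const] at hu hv ⊢
  have := hst T hT (fun t => φ t + u t) (fun t => deriv φ t + v t)
    (fun t ht => by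
      have h1 := IsSolOn.hasDerivAt hφ t
      have h2 := huv t ht
      refine ⟨h1.1.hasDerivWithinAt.add h2.1, ?_⟩
      convert! h1.2.hasDerivWithinAt.add h2.2 using 1
      ring)
    (by simpa using hu) (by simpa using hv)
  simpa using this

/-- A periodic solution whose linearization has trace larger than two is unstable. -/
theorem lyapunovUnstable_of_linTrace {G : ℝ → ℝ → ℝ}
    (hG : ContDiff ℝ 1 fun z : ℝ × ℝ => G z.1 z.2) {φ : ℝ → ℝ} (hφ : IsSol G φ) {T : ℝ}
    (hT : 0 < T) (hperG : ∀ x t, G x (t + T) = G x t) (hperφ : ∀ t, φ (t + T) = φ t)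
    (htr : 2 < linTrace G φ T) : LyapunovUnstable G φ := by
  intro hst
  have hqc := continuous_linCoeff hG hφ
  have hqper := linCoeff_periodic hperG hperφ
  obtain ⟨M, -, hM⟩ := exists_bound_of_periodic hqc hT hqper
  have hF := isFundamental_hillSol hqc hM
  rw [linTrace_eq] at htr
  set Q : ℝ × ℝ → ℝ := fun z => deriv (fun x => G x z.2) (φ z.2 + z.1) with hQ
  have hQc : Continuous Q := (continuous_deriv_slice hG).comp
    ((((IsSolOn.continuous hφ).1.comp continuous_snd).add continuous_fst).prodMk continuous_snd)
  have hQper : ∀ u t, Q (u, t + T) = Q (u, t) := fun u t => by simp only [hQ, hperG, hperφ]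
  -- Periodicity reduces all times to `[0, T]`, so compactness gives bounds on `Q` and a modulus of
  -- continuity uniform in `t`.
  have hred : ∀ t, ∃ s ∈ Icc 0 T, ∀ u, Q (u, t) = Q (u, s) := by
    intro t
    obtain ⟨s, hs, h⟩ := Function.Periodic.exists_mem_Ico₀
      (f := fun t u => Q (u, t)) (fun t => funext fun u => hQper u t) hT t
    exact ⟨s, Ico_subset_Icc_self hs, fun u => congrFun h u⟩
  have hcpt : IsCompact (Icc (-1 : ℝ) 1 ×ˢ Icc (0 : ℝ) T) := isCompact_Icc.prod isCompact_Icc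
  obtain ⟨K, hK⟩ := hcpt.exists_bound_of_continuousOn hQc.continuousOn
  have hH : ∀ t u, HasDerivAt (fun u => G (φ t + u) t - G (φ t) t) (Q (u, t)) u := by
    intro t u
    have h1 := (hasDerivAt_slice hG (φ t + u) t).differentiableAt.hasDerivAt
    exact (h1.comp_const_add (φ t) u).sub_const _
  refine hF.lyapunovUnstable hT hqper htr
    (H := fun u t => G (φ t + u) t - G (φ t) t) (K := K) ?_ (by simp) ?_ ?_ (hst.sub hφ)
  · have hφc := (IsSolOn.continuous hφ).1
    have hGc := hG.continuous
    exact (hGc.comp (((hφc.comp continuous_snd).add continuous_fst).prodMk continuous_snd)).sub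
      (hGc.comp ((hφc.comp continuous_snd).prodMk continuous_snd))
  · intro t x hx y hy
    refine (convex_Icc (-1 : ℝ) 1).norm_image_sub_le_of_norm_hasDerivWithin_le
      (fun u _ => (hH t u).hasDerivWithinAt) (fun u hu => ?_) hy hx
    obtain ⟨s, hs, h⟩ := hred t
    rw [h]
    exact hK (u, s) ⟨hu, hs⟩
  · intro κ hκ
    obtain ⟨d, hd, hunif⟩ := Metric.uniformContinuousOn_iff.1
      (hcpt.uniformContinuousOn_of_continuous hQc.continuousOn) κ hκ
    refine ⟨min (d / 2) 1, by positivity, fun t u hu => ?_⟩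
    have hq : linCoeff G φ t = Q (0, t) := by simp [linCoeff, hQ]
    rw [hq]
    obtain ⟨s, hs, h⟩ := hred t
    have hcl : ∀ r ∈ Icc (-|u|) |u|, |Q (r, t) - Q (0, t)| ≤ κ := by
      intro r hr
      have hr' : |r| ≤ min (d / 2) 1 := (abs_le.2 hr).trans hu
      rw [h, h, ← Real.dist_eq]
      refine (hunif (r, s) ⟨abs_le.1 (hr'.trans (min_le_right _ _)), hs⟩ (0, s)
        ⟨by norm_num, hs⟩ ?_).le
      rw [Prod.dist_eq, dist_self, max_eq_left dist_nonneg, Real.dist_eq, sub_zero]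
      linarith [hr'.trans (min_le_left _ _)]
    -- Mean value inequality for the nonlinear remainder, whose derivative `Q (r, t) - Q (0, t)` is
    -- at most `κ` in modulus.
    have := (convex_Icc (-|u|) |u|).norm_image_sub_le_of_norm_hasDerivWithin_le
      (f := fun u => G (φ t + u) t - G (φ t) t - Q (0, t) * u)
      (f' := fun r => Q (r, t) - Q (0, t)) (C := κ) (x := 0) (y := u)
      (fun r _ => by
        have := (hH t r).sub ((hasDerivAt_id r).const_mul (Q (0, t)))
        rw [mul_one] at this
        exact this.hasDerivWithinAt)
      hcl ⟨by simp, by simp⟩ ⟨neg_abs_le u, le_abs_self u⟩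
    simpa using this

theorem linearizedStable_of_isElliptic {G : ℝ → ℝ → ℝ}
    (hG : ContDiff ℝ 1 fun z : ℝ × ℝ => G z.1 z.2) {φ : ℝ → ℝ} (hφ : IsSol G φ) {T : ℝ}
    (hT : 0 < T) (hperG : ∀ x t, G x (t + T) = G x t) (hperφ : ∀ t, φ (t + T) = φ t)
    (hell : IsElliptic G φ T) : LinearizedStable G φ := by
  have hqc := continuous_linCoeff hG hφ
  have hqper := linCoeff_periodic hperG hperφ
  obtain ⟨M, -, hM⟩ := exists_bound_of_periodic hqc hT hqper
  rw [IsElliptic, linTrace_eq] at hell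
  exact (isFundamental_hillSol hqc hM).lyapunovStable hT hqper hell

/-! ### The odd periodic family -/

namespace IsAdmissible

variable {F : ℝ → ℝ → ℝ → ℝ} {f : ℝ → ℝ}

theorem contDiff_slice (hF : IsAdmissible F f) (e : ℝ) :
    ContDiff ℝ 1 fun z : ℝ × ℝ => F z.1 z.2 e :=
  (hF.smooth.of_le (by exact_mod_cast le_top)).comp
    (contDiff_fst.prodMk (contDiff_snd.prodMk contDiff_const))

theorem periodic_nat_mul (hF : IsAdmissible F f) (m : ℕ) (x t e : ℝ) :
    F x (t + 2 * (m * Real.pi)) e = F x t e := by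
  have h : Function.Periodic (fun t => F x t e) (2 * Real.pi) := fun t => hF.periodic_time x t e
  have := h.nat_mul m t
  rwa [show (m : ℝ) * (2 * Real.pi) = 2 * (m * Real.pi) by ring] at this

end IsAdmissible

theorem IsOddFamily.periodic {F : ℝ → ℝ → ℝ → ℝ} {f : ℝ → ℝ} (hF : IsAdmissible F f) {m : ℕ}
    {h e₀ : ℝ} {η : ℝ → ℝ} {φ : ℝ → ℝ → ℝ} (hφ : IsOddFamily F m h e₀ η φ) {e : ℝ}
    (he : e ∈ Ico 0 e₀) (t : ℝ) : φ (t + 2 * (m * Real.pi)) e = φ t e :=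
  (hφ.sol e he).periodic (hF.contDiff_slice e) (fun x t => hF.odd x t e)
    (fun x t => hF.even_time x t e) (fun x t => hF.periodic_nat_mul m x t e)
    (hφ.init_pos e he) (hφ.dirichlet e he) t

/-- At the autonomous end of the family the trace equals two. -/
theorem IsOddFamily.familyTrace_zero {F : ℝ → ℝ → ℝ → ℝ} {f : ℝ → ℝ} (hF : IsAdmissible F f)
    {m : ℕ} (hm : 0 < m) {h e₀ : ℝ} (hh : 0 < h) {η : ℝ → ℝ} {φ : ℝ → ℝ → ℝ}
    (hφ : IsOddFamily F m h e₀ η φ) : familyTrace F m φ 0 = 2 := by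
  have h0 : (0 : ℝ) ∈ Ico 0 e₀ := ⟨le_rfl, hφ.pos⟩
  have hFf : (fun x t => F x t 0) = fun x _ => f x :=
    funext fun x => funext fun t => hF.autonomous x t
  have hf : ContDiff ℝ 1 f := by
    have : f = fun x => F x 0 0 := funext fun x => (hF.autonomous x 0).symm
    rw [this]
    exact (hF.contDiff_slice 0).comp (contDiff_id.prodMk contDiff_const)
  have hf0 : f 0 = 0 := by
    have := hF.odd 0 0 0
    rw [neg_zero, hF.autonomous] at this
    linarith
  have hsol := hφ.sol 0 h0
  have hper := hφ.periodic hF h0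
  rw [familyTrace, hFf, mul_assoc]
  rw [hFf] at hsol
  refine linTrace_autonomous hf hf0 hsol (by positivity) hper (hφ.init_pos 0 h0) ?_
  rw [hφ.init_vel 0 h0, hφ.start]
  positivity

end NewtonEq

/-! ### From the sign of the derivative to the trace -/

/-- A nonzero `derivWithin` is not the default value 0, so it already entails differentiability. The
sign of the slope gives the upper bound; continuity gives the lower one, which for a trace with
value 2 at 0 excludes -2. -/
theorem eventually_lt_of_derivWithin_neg {g : ℝ → ℝ} {e₀ : ℝ} (he : 0 < e₀)
    (hg : derivWithin g (Ico 0 e₀) 0 < 0) : ∃ e₁ ∈ Ioc 0 e₀, ∀ e ∈ Ioo 0 e₁,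
      g e < g 0 ∧ g 0 - 1 < g e := by
  have hd := (differentiableWithinAt_of_derivWithin_ne_zero hg.ne).hasDerivWithinAt
  have hs : ∀ᶠ e in 𝓝[Ico 0 e₀ \ {0}] 0, slope g 0 e < 0 :=
    (hasDerivWithinAt_iff_tendsto_slope.1 hd).eventually (gt_mem_nhds hg)
  have hc : ∀ᶠ e in 𝓝[Ico 0 e₀ \ {0}] 0, g 0 - 1 < g e :=
    (hd.continuousWithinAt.mono sdiff_subset).eventually (lt_mem_nhds (by linarith))
  have hset : Ico 0 e₀ \ {0} = Ioo 0 e₀ := by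
    ext x
    simp only [Set.mem_sdiff, mem_Ico, mem_singleton_iff, mem_Ioo]
    grind
  rw [hset, nhdsWithin_Ioo_eq_nhdsGT he] at hs hc
  obtain ⟨e₁, he₁, h⟩ := (mem_nhdsGT_iff_exists_mem_Ioc_Ioo_subset he).1 (hs.and hc)
  refine ⟨e₁, he₁, fun e hee => ⟨?_, (h hee).2⟩⟩
  have h1 := (h hee).1
  rw [slope_def_field, sub_zero, div_lt_iff₀ hee.1, zero_mul] at h1
  linarith

theorem eventually_gt_of_derivWithin_pos {g : ℝ → ℝ} {e₀ : ℝ} (he : 0 < e₀)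
    (hg : 0 < derivWithin g (Ico 0 e₀) 0) : ∃ e₁ ∈ Ioc 0 e₀, ∀ e ∈ Ioo 0 e₁, g 0 < g e := by
  obtain ⟨e₁, he₁, h⟩ := eventually_lt_of_derivWithin_neg (g := fun e => -g e) he
    (by rw [derivWithin.fun_neg]; linarith)
  exact ⟨e₁, he₁, fun e hee => neg_lt_neg_iff.1 (h e hee).1⟩

theorem corollary3p3 (F : ℝ → ℝ → ℝ → ℝ) (f : ℝ → ℝ) (hF : NewtonEq.IsAdmissible F f)
    (m p : ℕ) (hm : 0 < m) (hp : 0 < p)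
    (h : ℝ) (h_pos : 0 < h) (h_lt : ∃ x : ℝ, h < NewtonEq.potential f x)
    (h_period : NewtonEq.periodFn f h = 2 * m * Real.pi / p)
    (h_nondeg : deriv (NewtonEq.periodFn f) h ≠ 0)
    (e₀ : ℝ) (η : ℝ → ℝ) (φ : ℝ → ℝ → ℝ) (hφ : NewtonEq.IsOddFamily F m h e₀ η φ) :
    (derivWithin (NewtonEq.familyTrace F m φ) (Set.Ico 0 e₀) 0 < 0 →
      ∃ e₁ ∈ Set.Ioc 0 e₀, ∀ e ∈ Set.Ioo 0 e₁,
        NewtonEq.IsElliptic (fun x t => F x t e) (fun t => φ t e) (2 * m * Real.pi) ∧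
        NewtonEq.LinearizedStable (fun x t => F x t e) (fun t => φ t e)) ∧
    (0 < derivWithin (NewtonEq.familyTrace F m φ) (Set.Ico 0 e₀) 0 →
      ∃ e₁ ∈ Set.Ioc 0 e₀, ∀ e ∈ Set.Ioo 0 e₁,
        NewtonEq.IsHyperbolic (fun x t => F x t e) (fun t => φ t e) (2 * m * Real.pi) ∧
        NewtonEq.LyapunovUnstable (fun x t => F x t e) (fun t => φ t e)) := by
  have hzero := hφ.familyTrace_zero hF hm h_pos
  have hT : 0 < 2 * m * Real.pi := by positivity
  have hperF : ∀ e x t, F x (t + 2 * m * Real.pi) e = F x t e := fun e x t => by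
    rw [mul_assoc]; exact hF.periodic_nat_mul m x t e
  have hperφ : ∀ e ∈ Set.Ico 0 e₀, ∀ t, φ (t + 2 * m * Real.pi) e = φ t e := fun e he t => by
    rw [mul_assoc]; exact hφ.periodic hF he t
  constructor
  · intro hneg
    obtain ⟨e₁, he₁, hlt⟩ := eventually_lt_of_derivWithin_neg hφ.pos hneg
    refine ⟨e₁, he₁, fun e he => ?_⟩
    have hmem : e ∈ Set.Ico 0 e₀ := ⟨he.1.le, he.2.trans_le he₁.2⟩
    have hell : NewtonEq.IsElliptic (fun x t => F x t e) (fun t => φ t e) (2 * m * Real.pi) := by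
      have := hlt e he
      rw [hzero] at this
      exact abs_lt.2 ⟨by linarith [this.2, show NewtonEq.familyTrace F m φ e =
        NewtonEq.linTrace (fun x t => F x t e) (fun t => φ t e) (2 * m * Real.pi) from rfl],
        this.1⟩
    exact ⟨hell, NewtonEq.linearizedStable_of_isElliptic (hF.contDiff_slice e)
      (hφ.sol e hmem) hT (hperF e) (hperφ e hmem) hell⟩
  · intro hpos
    obtain ⟨e₁, he₁, hgt⟩ := eventually_gt_of_derivWithin_pos hφ.pos hpos
    refine ⟨e₁, he₁, fun e he => ?_⟩
    have hmem : e ∈ Set.Ico 0 e₀ := ⟨he.1.le, he.2.trans_le he₁.2⟩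
    have htr : 2 < NewtonEq.linTrace (fun x t => F x t e) (fun t => φ t e)
        (2 * m * Real.pi) := by
      have := hgt e he
      rwa [hzero] at this
    exact ⟨htr.trans_le (le_abs_self _), NewtonEq.lyapunovUnstable_of_linTrace
      (hF.contDiff_slice e) (hφ.sol e hmem) hT (hperF e) (hperφ e hmem) htr⟩
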